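/- Let $(S_n)_{n\in\mathbb Z}$ and $(T_n)_{n\in\mathbb Z}$ be the two sequences generated by the Somos-5 recurrence $$\tau_{n+5}\tau_n=\tau_{n+4}\tau_{n+1}+\tau_{n+3}\tau_{n+2}$$ as follows. The sequence $(S_n)_{n\ge 0}$ is generated from $(S_0,S_1,S_2,S_3,S_4)=(1,1,1,2,3)$ (so it begins $1,1,1,2,3,5,11,37,83,274,\ldots$) and is extended to negative indices by $S_{-n}=S_n$. The sequence $(T_n)_{n\ge 1}$ is generated from $(T_1,T_2,T_3,T_4,T_5)=(1,-1,1,1,-7)$; with $T_0=0$ it begins $0,1,-1,1,1,-7,8,-1,-57,391,\ldots$, and it is extended to negative indices by $T_{-n}=-T_n$. For $n\in\mathbb Z$ define the signed lengths $$\bar s_n=-S_{n+3}S_{n+4}^2T_n^2T_{n+1},\qquad \bar a_n=-S_{n+2}T_{n+1}T_{n+2}^3T_{n+3},$$ $$\bar b_n=S_{n+1}S_{n+2}^3S_{n+3}T_{n+2},\qquad \bar c_n=S_n^2S_{n+1}T_{n+3}T_{n+4}^2.$$ Then $$\bar s_n=\bar a_n+\bar b_n+\bar c_n\qquad\text{for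 all } n\in\mathbb Z.$$ -/

import Mathlib

/-- The forward orbit of the Somos-5 recurrence
`τ (n+5) * τ n = τ (n+4) * τ (n+1) + τ (n+3) * τ (n+2)`
with initial values `τ 0, …, τ 4`, where each step solves the recurrence for `τ (n+5)`. -/
def somos5 (x₀ x₁ x₂ x₃ x₄ : ℚ) : ℕ → ℚ
  | 0 => x₀
  | 1 => x₁
  | 2 => x₂
  | 3 => x₃
  | 4 => x₄
  | n + 5 =>
      (somos5 x₀ x₁ x₂ x₃ x₄ (n + 4) * somos5 x₀ x₁ x₂ x₃ x₄ (n + 1)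
        + somos5 x₀ x₁ x₂ x₃ x₄ (n + 3) * somos5 x₀ x₁ x₂ x₃ x₄ (n + 2))
      / somos5 x₀ x₁ x₂ x₃ x₄ n

/-- The sequence `(S n)`: `1, 1, 1, 2, 3, 5, 11, 37, 83, 274, …` from `n = 0`,
generated by the Somos-5 recurrence and extended symmetrically, `S (-n) = S n`. -/
def somosS (n : ℤ) : ℚ :=
  somos5 1 1 1 2 3 n.natAbs

/-- The sequence `(T n)`: `0, 1, -1, 1, 1, -7, 8, -1, -57, 391, …` from `n = 0`,
extended antisymmetrically, `T (-n) = -T n`. As `T 0 = 0`, the recurrence at `n = 0` does not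
determine `T 5`, so the sequence is generated from `T 1, …, T 5`; at `n = 0` the factor
`n.sign` gives `T 0 = 0`. -/
def somosT (n : ℤ) : ℚ :=
  (n.sign : ℚ) * somos5 1 (-1) 1 1 (-7) (n.natAbs - 1)

/-- The signed length `s̄ n`. -/
def sBar (n : ℤ) : ℚ :=
  -somosS (n + 3) * somosS (n + 4) ^ 2 * somosT n ^ 2 * somosT (n + 1)

/-- The signed length `ā n`. -/
def aBar (n : ℤ) : ℚ :=
  -somosS (n + 2) * somosT (n + 1) * somosT (n + 2) ^ 3 * somosT (n + 3)

/-- The signed length `b̄ n`. -/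
def bBar (n : ℤ) : ℚ :=
  somosS (n + 1) * somosS (n + 2) ^ 3 * somosS (n + 3) * somosT (n + 2)

/-- The signed length `c̄ n`. -/
def cBar (n : ℤ) : ℚ :=
  somosS n ^ 2 * somosS (n + 1) * somosT (n + 3) * somosT (n + 4) ^ 2

/-! Set z = T/S. Neighbouring ratios lie on the biquadratic curve cut out by `invariant`, and the
sequence is a QRT orbit on it: with one ratio fixed, its two neighbours are the two roots of a
quadratic. Vieta's formulas split into formulas for S(n+1)S(n-1), for S(n+1)T(n-1) + S(n-1)T(n+1)
and for T(n+1)T(n-1) in terms of S(n), T(n), depending on the parity of n. Conversely, the first two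
relations determine the next terms with division by S only. So a pair is built from these relations
(`somosState`, `SomosPair`). Any identity on a window of indices becomes a rational identity in two
adjacent terms of each sequence, true modulo the invariant. In this way both sequences satisfy
Somos-5 (`SomosPair.somos_five`) and the cubic relation (`SomosPair.signed_length`). Identifying the
pair with the given sequences, which are generated by division, requires that no divisor vanish. For
S this is positivity. For T it comes by strong induction from the duplication formulas
(`SomosPair.double`): a zero at 2m or 2m+1 would make 17 or 2 a rational square. -/

/-- The biquadratic form vanishing at consecutive terms of a `SomosPair`: `p`, `q` are the terms of
odd index and `u`, `v` those of even index. -/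
def invariant (p q u v : ℚ) : ℚ :=
  3 * u * v * p * q + (u ^ 2 + v ^ 2) * q ^ 2 + (2 * v ^ 2 - u ^ 2) * p ^ 2

/-! ### Window identities modulo the invariant. -/

/-- Applied with `d` the invariant: once everything is expressed in `p`, `q`, `u`, `v`, the explicit
`c` in each use is the quotient of the difference of the two sides by the invariant. -/
theorem eq_of_sub_eq_mul {a b c d : ℚ} (hd : d = 0) (h : a - b = c * d) : a = b := by
  rw [hd, mul_zero] at h
  exact sub_eq_zero.mp h

theorem next_odd {p q u v p' q' : ℚ} (hp : p ≠ 0) (h : p' * p = u ^ 2 + v ^ 2)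
    (h' : p' * q + p * q' = -(3 * u * v)) :
    p' = (u ^ 2 + v ^ 2) / p ∧ q' = -(3 * u * v + (u ^ 2 + v ^ 2) / p * q) / p := by
  obtain rfl : p' = (u ^ 2 + v ^ 2) / p := (eq_div_iff hp).2 h
  exact ⟨rfl, (eq_div_iff hp).2 (by linear_combination h')⟩

theorem next_even {p q u v u' v' : ℚ} (hu : u ≠ 0) (h : 3 * (u' * u) = 2 * p ^ 2 + q ^ 2)
    (h' : u' * v + u * v' = -(p * q)) :
    u' = (2 * p ^ 2 + q ^ 2) / (3 * u) ∧
      v' = -(p * q + (2 * p ^ 2 + q ^ 2) / (3 * u) * v) / u := by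
  obtain rfl : u' = (2 * p ^ 2 + q ^ 2) / (3 * u) :=
    (eq_div_iff (by positivity)).2 (by linear_combination h)
  exact ⟨rfl, (eq_div_iff hu).2 (by linear_combination h')⟩

/-- Vieta: the hypotheses give the sum of `q / p` and `q₁ / p₁` as that of the roots of the
invariant, viewed as a quadratic in `q / p`, so the new ratio is the other root. -/
theorem invariant_succ_even {p q u v p₁ q₁ : ℚ} (hp : p ≠ 0)
    (hI : invariant p q u v = 0)
    (h₁ : p₁ * p = u ^ 2 + v ^ 2) (h₁' : p₁ * q + p * q₁ = -(3 * u * v)) :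
    invariant p₁ q₁ u v = 0 := by
  obtain ⟨rfl, rfl⟩ := next_odd hp h₁ h₁'
  refine eq_of_sub_eq_mul (c := (v ^ 4 + 2 * u ^ 2 * v ^ 2 + u ^ 4) / p ^ 4) hI ?_
  unfold invariant
  field_simp
  ring

theorem invariant_succ_odd {p q u v u₁ v₁ : ℚ} (hu : u ≠ 0)
    (hI : invariant p q u v = 0)
    (h₂ : 3 * (u₁ * u) = 2 * p ^ 2 + q ^ 2) (h₂' : u₁ * v + u * v₁ = -(p * q)) :
    invariant p q u₁ v₁ = 0 := by
  obtain ⟨rfl, rfl⟩ := next_even hu h₂ h₂'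
  refine eq_of_sub_eq_mul (c := (1/9 * q ^ 4 + 4/9 * p ^ 2 * q ^ 2 + 4/9 * p ^ 4) / u ^ 4) hI ?_
  unfold invariant
  field_simp
  ring

/-- The product of the two roots, the remaining Vieta formula. -/
theorem anti_mul_even {p q u v p₁ q₁ : ℚ} (hp : p ≠ 0)
    (hI : invariant p q u v = 0)
    (h₁ : p₁ * p = u ^ 2 + v ^ 2) (h₁' : p₁ * q + p * q₁ = -(3 * u * v)) :
    q₁ * q = 2 * v ^ 2 - u ^ 2 := by
  obtain ⟨rfl, rfl⟩ := next_odd hp h₁ h₁'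
  refine eq_of_sub_eq_mul (c := (-1) / p ^ 2) hI ?_
  unfold invariant
  field_simp
  ring

theorem anti_mul_odd {p q u v u₁ v₁ : ℚ} (hu : u ≠ 0)
    (hI : invariant p q u v = 0)
    (h₂ : 3 * (u₁ * u) = 2 * p ^ 2 + q ^ 2) (h₂' : u₁ * v + u * v₁ = -(p * q)) :
    3 * (v₁ * v) = q ^ 2 - p ^ 2 := by
  obtain ⟨rfl, rfl⟩ := next_even hu h₂ h₂'
  refine eq_of_sub_eq_mul (c := (-1) / u ^ 2) hI ?_
  unfold invariant
  field_simp
  ring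

/-- The six consecutive terms are `u₂, p₁, u, p, u₁, p₀`. Read forwards they serve a window starting
at an even index, read backwards one starting at an odd index. -/
theorem somos_sym {p q u v p₁ q₁ u₁ v₁ u₂ v₂ p₀ q₀ : ℚ} (hp : p ≠ 0) (hu : u ≠ 0)
    (hI : invariant p q u v = 0)
    (h₁ : p₁ * p = u ^ 2 + v ^ 2) (h₁' : p₁ * q + p * q₁ = -(3 * u * v))
    (h₂ : 3 * (u₁ * u) = 2 * p ^ 2 + q ^ 2) (h₂' : u₁ * v + u * v₁ = -(p * q))
    (h₄ : 3 * (u₂ * u) = 2 * p₁ ^ 2 + q₁ ^ 2) (h₄' : u₂ * v + u * v₂ = -(p₁ * q₁))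
    (h₃ : p₀ * p = u₁ ^ 2 + v₁ ^ 2) (h₃' : p₀ * q + p * q₀ = -(3 * u₁ * v₁)) :
    u₂ * p₀ = p₁ * u₁ + u * p := by
  obtain ⟨rfl, rfl⟩ := next_odd hp h₁ h₁'
  obtain ⟨rfl, rfl⟩ := next_even hu h₂ h₂'
  obtain ⟨rfl, rfl⟩ := next_even hu h₄ h₄'
  obtain ⟨rfl, rfl⟩ := next_odd hp h₃ h₃'
  refine eq_of_sub_eq_mul (c := (1/27 * q ^ 4 * v ^ 4 + 2/27 * q ^ 4 * u ^ 2 * v ^ 2 + 1/27 * q ^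
    4 * u ^ 4 + 1/3 * p * q ^ 3 * u * v ^ 3 + 1/3 * p * q ^ 3 * u ^ 3 * v + 4/27 * p ^ 2 * q ^ 2 *
    v ^ 4 + 38/27 * p ^ 2 * q ^ 2 * u ^ 2 * v ^ 2 + 16/27 * p ^ 2 * q ^ 2 * u ^ 4 + 2/3 * p ^ 3 *
    q * u * v ^ 3 + 7/3 * p ^ 3 * q * u ^ 3 * v + 4/27 * p ^ 4 * v ^ 4 + 32/27 * p ^ 4 * u ^ 2 * v
    ^ 2 + 37/27 * p ^ 4 * u ^ 4) / (p ^ 5 * u ^ 5)) hI ?_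
  unfold invariant
  field_simp
  ring

theorem somos_anti {p q u v p₁ q₁ u₁ v₁ u₂ v₂ p₀ q₀ : ℚ} (hp : p ≠ 0) (hu : u ≠ 0)
    (hI : invariant p q u v = 0)
    (h₁ : p₁ * p = u ^ 2 + v ^ 2) (h₁' : p₁ * q + p * q₁ = -(3 * u * v))
    (h₂ : 3 * (u₁ * u) = 2 * p ^ 2 + q ^ 2) (h₂' : u₁ * v + u * v₁ = -(p * q))
    (h₄ : 3 * (u₂ * u) = 2 * p₁ ^ 2 + q₁ ^ 2) (h₄' : u₂ * v + u * v₂ = -(p₁ * q₁))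
    (h₃ : p₀ * p = u₁ ^ 2 + v₁ ^ 2) (h₃' : p₀ * q + p * q₀ = -(3 * u₁ * v₁)) :
    v₂ * q₀ = q₁ * v₁ + v * q := by
  obtain ⟨rfl, rfl⟩ := next_odd hp h₁ h₁'
  obtain ⟨rfl, rfl⟩ := next_even hu h₂ h₂'
  obtain ⟨rfl, rfl⟩ := next_even hu h₄ h₄'
  obtain ⟨rfl, rfl⟩ := next_odd hp h₃ h₃'
  refine eq_of_sub_eq_mul (c := (1/27 * q ^ 5 * v ^ 5 + 2/27 * q ^ 5 * u ^ 2 * v ^ 3 + 1/27 * q ^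
    5 * u ^ 4 * v + 1/9 * p * q ^ 4 * u * v ^ 4 - 1/9 * p * q ^ 4 * u ^ 5 + 4/27 * p ^ 2 * q ^ 3 *
    v ^ 5 + 11/27 * p ^ 2 * q ^ 3 * u ^ 2 * v ^ 3 - 2/27 * p ^ 2 * q ^ 3 * u ^ 4 * v - 2/9 * p ^ 3
    * q ^ 2 * u ^ 3 * v ^ 2 - 5/9 * p ^ 3 * q ^ 2 * u ^ 5 + 4/27 * p ^ 4 * q * v ^ 5 - 4/27 * p ^
    4 * q * u ^ 2 * v ^ 3 - 8/27 * p ^ 4 * q * u ^ 4 * v - 4/9 * p ^ 5 * u * v ^ 4 - 10/9 * p ^ 5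
    * u ^ 3 * v ^ 2) / (p ^ 6 * u ^ 6)) hI ?_
  unfold invariant
  field_simp
  ring

theorem mixed_two_even {p q u v p₁ q₁ u₁ v₁ u₂ v₂ : ℚ} (hp : p ≠ 0) (hu : u ≠ 0)
    (hI : invariant p q u v = 0)
    (h₁ : p₁ * p = u ^ 2 + v ^ 2) (h₁' : p₁ * q + p * q₁ = -(3 * u * v))
    (h₂ : 3 * (u₁ * u) = 2 * p ^ 2 + q ^ 2) (h₂' : u₁ * v + u * v₁ = -(p * q))
    (h₄ : 3 * (u₂ * u) = 2 * p₁ ^ 2 + q₁ ^ 2) (h₄' : u₂ * v + u * v₂ = -(p₁ * q₁)) :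
    u₂ * v₁ = -(2 * u * v) - p₁ * q := by
  obtain ⟨rfl, rfl⟩ := next_odd hp h₁ h₁'
  obtain ⟨rfl, rfl⟩ := next_even hu h₂ h₂'
  obtain ⟨rfl, rfl⟩ := next_even hu h₄ h₄'
  refine eq_of_sub_eq_mul (c := (-1/9 * q ^ 2 * v ^ 3 - 1/9 * q ^ 2 * u ^ 2 * v - 2/3 * p * q * u
    * v ^ 2 - 1/3 * p * q * u ^ 3 - 2/9 * p ^ 2 * v ^ 3 - 14/9 * p ^ 2 * u ^ 2 * v) / (p ^ 4 * u ^
    3)) hI ?_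
  unfold invariant
  field_simp
  ring

theorem mixed_two_even_symm {p q u v p₁ q₁ u₁ v₁ u₂ v₂ : ℚ} (hp : p ≠ 0) (hu : u ≠ 0)
    (hI : invariant p q u v = 0)
    (h₁ : p₁ * p = u ^ 2 + v ^ 2) (h₁' : p₁ * q + p * q₁ = -(3 * u * v))
    (h₂ : 3 * (u₁ * u) = 2 * p ^ 2 + q ^ 2) (h₂' : u₁ * v + u * v₁ = -(p * q))
    (h₄ : 3 * (u₂ * u) = 2 * p₁ ^ 2 + q₁ ^ 2) (h₄' : u₂ * v + u * v₂ = -(p₁ * q₁)) :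
    u₁ * v₂ = -(2 * u * v) - p * q₁ := by
  obtain ⟨rfl, rfl⟩ := next_odd hp h₁ h₁'
  obtain ⟨rfl, rfl⟩ := next_even hu h₂ h₂'
  obtain ⟨rfl, rfl⟩ := next_even hu h₄ h₄'
  refine eq_of_sub_eq_mul (c := (-1/9 * q ^ 2 * v ^ 3 - 1/9 * q ^ 2 * u ^ 2 * v + 1/3 * p * q * u
    ^ 3 - 2/9 * p ^ 2 * v ^ 3 - 5/9 * p ^ 2 * u ^ 2 * v) / (p ^ 4 * u ^ 3)) hI ?_
  unfold invariant
  field_simp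
  ring

theorem mixed_two_odd {p q u v p₁ q₁ u₁ v₁ p₀ q₀ : ℚ} (hp : p ≠ 0) (hu : u ≠ 0)
    (hI : invariant p q u v = 0)
    (h₁ : p₁ * p = u ^ 2 + v ^ 2) (h₁' : p₁ * q + p * q₁ = -(3 * u * v))
    (h₂ : 3 * (u₁ * u) = 2 * p ^ 2 + q ^ 2) (h₂' : u₁ * v + u * v₁ = -(p * q))
    (h₃ : p₀ * p = u₁ ^ 2 + v₁ ^ 2) (h₃' : p₀ * q + p * q₀ = -(3 * u₁ * v₁)) :
    p₁ * q₀ = -(2 * p * q) - 3 * (u * v₁) := by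
  obtain ⟨rfl, rfl⟩ := next_odd hp h₁ h₁'
  obtain ⟨rfl, rfl⟩ := next_even hu h₂ h₂'
  obtain ⟨rfl, rfl⟩ := next_odd hp h₃ h₃'
  refine eq_of_sub_eq_mul (c := (-1/9 * q ^ 3 * v ^ 2 - 1/9 * q ^ 3 * u ^ 2 - 2/9 * p ^ 2 * q * v
    ^ 2 - 5/9 * p ^ 2 * q * u ^ 2 + 2/3 * p ^ 3 * u * v) / (p ^ 3 * u ^ 4)) hI ?_
  unfold invariant
  field_simp
  ring

theorem mixed_two_odd_symm {p q u v p₁ q₁ u₁ v₁ p₀ q₀ : ℚ} (hp : p ≠ 0) (hu : u ≠ 0)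
    (hI : invariant p q u v = 0)
    (h₁ : p₁ * p = u ^ 2 + v ^ 2) (h₁' : p₁ * q + p * q₁ = -(3 * u * v))
    (h₂ : 3 * (u₁ * u) = 2 * p ^ 2 + q ^ 2) (h₂' : u₁ * v + u * v₁ = -(p * q))
    (h₃ : p₀ * p = u₁ ^ 2 + v₁ ^ 2) (h₃' : p₀ * q + p * q₀ = -(3 * u₁ * v₁)) :
    p₀ * q₁ = -(2 * p * q) - 3 * (u₁ * v) := by
  obtain ⟨rfl, rfl⟩ := next_odd hp h₁ h₁'
  obtain ⟨rfl, rfl⟩ := next_even hu h₂ h₂'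
  obtain ⟨rfl, rfl⟩ := next_odd hp h₃ h₃'
  refine eq_of_sub_eq_mul (c := (-1/9 * q ^ 3 * v ^ 2 - 1/9 * q ^ 3 * u ^ 2 - 2/3 * p * q ^ 2 * u
    * v - 2/9 * p ^ 2 * q * v ^ 2 - 14/9 * p ^ 2 * q * u ^ 2 - 2/3 * p ^ 3 * u * v) / (p ^ 3 * u ^
    4)) hI ?_
  unfold invariant
  field_simp
  ring

/-! ### Algebra behind the duplication formulas. -/

/-- The relation centred at 2m+1 with the duplication formulas inserted; `p`, `q` and `u`, `v` are
the terms at whichever of m, m+1 is odd and even. -/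
theorem double_sym_mul (p q u v : ℚ) :
    3 * (((2 * p ^ 4 + q ^ 4) / 3) * (u ^ 4 + 2 * v ^ 4)) =
      2 * (u ^ 2 * p ^ 2 + v ^ 2 * q ^ 2) ^ 2 + (u ^ 2 * q ^ 2 - 2 * v ^ 2 * p ^ 2) ^ 2 := by
  ring

theorem double_mixed {p q u v p₁ q₁ u₁ v₁ : ℚ} (hp : p ≠ 0) (hu : u ≠ 0)
    (hI : invariant p q u v = 0)
    (h₁ : p₁ * p = u ^ 2 + v ^ 2) (h₁' : p₁ * q + p * q₁ = -(3 * u * v))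
    (h₂ : 3 * (u₁ * u) = 2 * p ^ 2 + q ^ 2) (h₂' : u₁ * v + u * v₁ = -(p * q)) :
    ((2 * p ^ 4 + q ^ 4) / 3) * (-(u * v * (p * q₁ - p₁ * q))) +
      (u ^ 4 + 2 * v ^ 4) * (-(p * q * (u₁ * v - u * v₁))) =
      -((u ^ 2 * p ^ 2 + v ^ 2 * q ^ 2) * (u ^ 2 * q ^ 2 - 2 * v ^ 2 * p ^ 2)) := by
  obtain ⟨rfl, rfl⟩ := next_odd hp h₁ h₁'
  obtain ⟨rfl, rfl⟩ := next_even hu h₂ h₂'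
  refine eq_of_sub_eq_mul (c := (2/3 * q ^ 3 * u ^ 2 * v - 4/3 * p ^ 2 * q * v ^ 3) / (p ^ 1 * u ^
    1)) hI ?_
  unfold invariant
  field_simp
  ring

theorem double_succ_sym_mul_odd {p q u v u₁ v₁ : ℚ} (hu : u ≠ 0)
    (hI : invariant p q u v = 0)
    (h₂ : 3 * (u₁ * u) = 2 * p ^ 2 + q ^ 2) (h₂' : u₁ * v + u * v₁ = -(p * q)) :
    (u₁ ^ 2 * p ^ 2 + v₁ ^ 2 * q ^ 2) * (u ^ 2 * p ^ 2 + v ^ 2 * q ^ 2) =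
      ((2 * p ^ 4 + q ^ 4) / 3) ^ 2 + (-(p * q * (u₁ * v - u * v₁))) ^ 2 := by
  obtain ⟨rfl, rfl⟩ := next_even hu h₂ h₂'
  refine eq_of_sub_eq_mul (c := (1/9 * q ^ 6 * v ^ 2 - 1/9 * q ^ 6 * u ^ 2 + 1/3 * p * q ^ 5 * u *
    v + 2/9 * p ^ 2 * q ^ 4 * v ^ 2 - 1/9 * p ^ 2 * q ^ 4 * u ^ 2 - 4/9 * p ^ 4 * q ^ 2 * u ^ 2) /
    u ^ 4) hI ?_
  unfold invariant
  field_simp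
  ring

theorem double_succ_mixed_odd {p q u v u₁ v₁ : ℚ} (hu : u ≠ 0)
    (h₂ : 3 * (u₁ * u) = 2 * p ^ 2 + q ^ 2) (h₂' : u₁ * v + u * v₁ = -(p * q)) :
    (u₁ ^ 2 * p ^ 2 + v₁ ^ 2 * q ^ 2) * (u ^ 2 * q ^ 2 - 2 * v ^ 2 * p ^ 2) -
        (u ^ 2 * p ^ 2 + v ^ 2 * q ^ 2) * (u₁ ^ 2 * q ^ 2 - 2 * v₁ ^ 2 * p ^ 2) =
      -(3 * ((2 * p ^ 4 + q ^ 4) / 3) * (-(p * q * (u₁ * v - u * v₁)))) := by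
  obtain ⟨rfl, rfl⟩ := next_even hu h₂ h₂'
  field_simp
  ring

theorem double_succ_sym_mul_even {p q u v p₁ q₁ : ℚ} (hp : p ≠ 0)
    (hI : invariant p q u v = 0)
    (h₁ : p₁ * p = u ^ 2 + v ^ 2) (h₁' : p₁ * q + p * q₁ = -(3 * u * v)) :
    (u ^ 2 * p₁ ^ 2 + v ^ 2 * q₁ ^ 2) * (u ^ 2 * p ^ 2 + v ^ 2 * q ^ 2) =
      (u ^ 4 + 2 * v ^ 4) ^ 2 + (-(u * v * (p * q₁ - p₁ * q))) ^ 2 := by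
  obtain ⟨rfl, rfl⟩ := next_odd hp h₁ h₁'
  refine eq_of_sub_eq_mul (c := (q ^ 2 * v ^ 6 + q ^ 2 * u ^ 2 * v ^ 4 + 3 * p * q * u * v ^ 5 - 2
    * p ^ 2 * v ^ 6 - p ^ 2 * u ^ 2 * v ^ 4 - 2 * p ^ 2 * u ^ 4 * v ^ 2) / p ^ 4) hI ?_
  unfold invariant
  field_simp
  ring

theorem double_succ_mixed_even {p q u v p₁ q₁ : ℚ} (hp : p ≠ 0)
    (h₁ : p₁ * p = u ^ 2 + v ^ 2) (h₁' : p₁ * q + p * q₁ = -(3 * u * v)) :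
    (u ^ 2 * p ^ 2 + v ^ 2 * q ^ 2) * (u ^ 2 * q₁ ^ 2 - 2 * v ^ 2 * p₁ ^ 2) -
        (u ^ 2 * p₁ ^ 2 + v ^ 2 * q₁ ^ 2) * (u ^ 2 * q ^ 2 - 2 * v ^ 2 * p ^ 2) =
      -(3 * (u ^ 4 + 2 * v ^ 4) * (-(-(u * v * (p * q₁ - p₁ * q))))) := by
  obtain ⟨rfl, rfl⟩ := next_odd hp h₁ h₁'
  field_simp
  ring

/-! ### The cubic identity. -/

/-- Since X = y + uv and Y = x + uv, the sum xX² + yY² is symmetric in x and y, hence determined by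
x + y and xy, which the central terms u, v give. -/
theorem signed_length_even {x y X Y u v s t w : ℚ} (hX : X = -(2 * u * v) - x)
    (hY : Y = -(2 * u * v) - y) (hxy : x + y = -(3 * u * v)) (hs : s = u ^ 2 + v ^ 2)
    (ht : t = 2 * v ^ 2 - u ^ 2) (hw : w = u * v) (hq : x * y = s * t) :
    -(x * X ^ 2) = w * (s * u ^ 2 - t * v ^ 2) + y * Y ^ 2 := by
  obtain rfl : y = -(3 * u * v) - x := by linear_combination hxy
  subst hX hY hs ht hw
  linear_combination -(u * v) * hq

theorem signed_length_odd {x y X Y u v s t w : ℚ} (hX : X = -(2 * u * v) - 3 * x)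
    (hY : Y = -(2 * u * v) - 3 * y) (hxy : x + y = -(u * v)) (hs : 3 * s = 2 * u ^ 2 + v ^ 2)
    (ht : 3 * t = v ^ 2 - u ^ 2) (hw : w = u * v) (hq : x * y = s * t) :
    -(x * X ^ 2) = w * (s * u ^ 2 - t * v ^ 2) + y * Y ^ 2 := by
  obtain rfl : y = -(u * v) - x := by linear_combination hxy
  obtain rfl : s = (2 * u ^ 2 + v ^ 2) / 3 := by linear_combination hs / 3
  obtain rfl : t = (v ^ 2 - u ^ 2) / 3 := by linear_combination ht / 3
  subst hX hY hw
  linear_combination -(3 * u * v) * hq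

/-! ### Pairs over the integers, Somos-5 and the cubic relation. -/

/-- Two sequences with `S` nowhere zero whose products at neighbouring indices are quadratic forms
in the terms at the central index, the forms depending on the parity of that index. -/
structure SomosPair (S T : ℤ → ℚ) : Prop where
  sym_ne : ∀ n, S n ≠ 0
  sym_even : ∀ n, Even n → S (n + 1) * S (n - 1) = S n ^ 2 + T n ^ 2
  sym_odd : ∀ n, Odd n → 3 * (S (n + 1) * S (n - 1)) = 2 * S n ^ 2 + T n ^ 2
  mixed_even : ∀ n, Even n → S (n + 1) * T (n - 1) + S (n - 1) * T (n + 1) = -(3 * S n * T n)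
  mixed_odd : ∀ n, Odd n → S (n + 1) * T (n - 1) + S (n - 1) * T (n + 1) = -(S n * T n)
  invariant_even : ∀ n, Even n → invariant (S (n + 1)) (T (n + 1)) (S n) (T n) = 0
  invariant_odd : ∀ n, Odd n → invariant (S n) (T n) (S (n + 1)) (T (n + 1)) = 0

namespace SomosPair

variable {S T : ℤ → ℚ} {a b c n : ℤ}

theorem sym_mul_of_even (h : SomosPair S T) (hb : Even b)
    (hac : a = b + 1 ∧ c = b - 1 ∨ a = b - 1 ∧ c = b + 1) : S a * S c = S b ^ 2 + T b ^ 2 := by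
  rcases hac with ⟨rfl, rfl⟩ | ⟨rfl, rfl⟩ <;> linear_combination h.sym_even b hb

theorem sym_mul_of_odd (h : SomosPair S T) (hb : Odd b)
    (hac : a = b + 1 ∧ c = b - 1 ∨ a = b - 1 ∧ c = b + 1) :
    3 * (S a * S c) = 2 * S b ^ 2 + T b ^ 2 := by
  rcases hac with ⟨rfl, rfl⟩ | ⟨rfl, rfl⟩ <;> linear_combination h.sym_odd b hb

theorem mixed_of_even (h : SomosPair S T) (hb : Even b)
    (hac : a = b + 1 ∧ c = b - 1 ∨ a = b - 1 ∧ c = b + 1) :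
    S a * T c + S c * T a = -(3 * S b * T b) := by
  rcases hac with ⟨rfl, rfl⟩ | ⟨rfl, rfl⟩ <;> linear_combination h.mixed_even b hb

theorem mixed_of_odd (h : SomosPair S T) (hb : Odd b)
    (hac : a = b + 1 ∧ c = b - 1 ∨ a = b - 1 ∧ c = b + 1) :
    S a * T c + S c * T a = -(S b * T b) := by
  rcases hac with ⟨rfl, rfl⟩ | ⟨rfl, rfl⟩ <;> linear_combination h.mixed_odd b hb

theorem invariant_eq_zero (h : SomosPair S T) (hb : Even b) (hab : a = b + 1 ∨ a = b - 1) :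
    invariant (S a) (T a) (S b) (T b) = 0 := by
  rcases hab with rfl | rfl
  · exact h.invariant_even b hb
  · simpa using h.invariant_odd (b - 1) (by grind)

theorem anti_mul_of_even (h : SomosPair S T) (hb : Even b) :
    T (b + 1) * T (b - 1) = 2 * T b ^ 2 - S b ^ 2 :=
  anti_mul_even (h.sym_ne (b - 1)) (h.invariant_eq_zero hb (by omega))
    (h.sym_mul_of_even hb (by omega)) (h.mixed_of_even hb (by omega))

theorem anti_mul_of_odd (h : SomosPair S T) (hb : Odd b) :
    3 * (T (b + 1) * T (b - 1)) = T b ^ 2 - S b ^ 2 :=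
  anti_mul_odd (h.sym_ne (b - 1)) (h.invariant_eq_zero (by grind) (by omega))
    (h.sym_mul_of_odd hb (by omega)) (h.mixed_of_odd hb (by omega))

/-- Both sequences satisfy the Somos-5 recurrence. -/
theorem somos_five (h : SomosPair S T) (n : ℤ) :
    S (n + 5) * S n = S (n + 4) * S (n + 1) + S (n + 3) * S (n + 2) ∧
      T (n + 5) * T n = T (n + 4) * T (n + 1) + T (n + 3) * T (n + 2) := by
  rcases Int.even_or_odd n with hn | hn
  · have h2 : Even (n + 2) := by grind
    have h4 : Even (n + 4) := by grind
    have h1 : Odd (n + 1) := by grind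
    have h3 : Odd (n + 3) := by grind
    have e1 := h.sym_mul_of_even (a := n + 1) (c := n + 3) h2 (by omega)
    have e1' := h.mixed_of_even (a := n + 1) (c := n + 3) h2 (by omega)
    have e2 := h.sym_mul_of_odd (a := n + 4) (c := n + 2) h3 (by omega)
    have e2' := h.mixed_of_odd (a := n + 4) (c := n + 2) h3 (by omega)
    have e3 := h.sym_mul_of_even (a := n + 5) (c := n + 3) h4 (by omega)
    have e3' := h.mixed_of_even (a := n + 5) (c := n + 3) h4 (by omega)
    have e4 := h.sym_mul_of_odd (a := n) (c := n + 2) h1 (by omega)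
    have e4' := h.mixed_of_odd (a := n) (c := n + 2) h1 (by omega)
    have hI := h.invariant_eq_zero (a := n + 3) h2 (by omega)
    have hS := somos_sym (h.sym_ne _) (h.sym_ne _) hI e1 e1' e2 e2' e4 e4' e3 e3'
    have hT := somos_anti (h.sym_ne _) (h.sym_ne _) hI e1 e1' e2 e2' e4 e4' e3 e3'
    constructor <;> linarith
  · have h2 : Odd (n + 2) := by grind
    have h4 : Odd (n + 4) := by grind
    have h1 : Even (n + 1) := by grind
    have h3 : Even (n + 3) := by grind
    have e1 := h.sym_mul_of_even (a := n + 4) (c := n + 2) h3 (by omega)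
    have e1' := h.mixed_of_even (a := n + 4) (c := n + 2) h3 (by omega)
    have e2 := h.sym_mul_of_odd (a := n + 1) (c := n + 3) h2 (by omega)
    have e2' := h.mixed_of_odd (a := n + 1) (c := n + 3) h2 (by omega)
    have e3 := h.sym_mul_of_even (a := n) (c := n + 2) h1 (by omega)
    have e3' := h.mixed_of_even (a := n) (c := n + 2) h1 (by omega)
    have e4 := h.sym_mul_of_odd (a := n + 5) (c := n + 3) h4 (by omega)
    have e4' := h.mixed_of_odd (a := n + 5) (c := n + 3) h4 (by omega)
    have hI := h.invariant_eq_zero (a := n + 2) h3 (by omega)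
    have hS := somos_sym (h.sym_ne _) (h.sym_ne _) hI e1 e1' e2 e2' e4 e4' e3 e3'
    have hT := somos_anti (h.sym_ne _) (h.sym_ne _) hI e1 e1' e2 e2' e4 e4' e3 e3'
    constructor <;> linarith

/-- The cubic identity behind the relation between the signed lengths. -/
theorem signed_length (h : SomosPair S T) (n : ℤ) :
    -S (n + 3) * S (n + 4) ^ 2 * T n ^ 2 * T (n + 1) =
      -S (n + 2) * T (n + 1) * T (n + 2) ^ 3 * T (n + 3) +
        S (n + 1) * S (n + 2) ^ 3 * S (n + 3) * T (n + 2) +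
        S n ^ 2 * S (n + 1) * T (n + 3) * T (n + 4) ^ 2 := by
  rcases Int.even_or_odd n with hn | hn
  · have h2 : Even (n + 2) := by grind
    have h1 : Odd (n + 1) := by grind
    have h3 : Odd (n + 3) := by grind
    have e1 := h.sym_mul_of_even (a := n + 1) (c := n + 3) h2 (by omega)
    have e1' := h.mixed_of_even (a := n + 1) (c := n + 3) h2 (by omega)
    have e2 := h.sym_mul_of_odd (a := n + 4) (c := n + 2) h3 (by omega)
    have e2' := h.mixed_of_odd (a := n + 4) (c := n + 2) h3 (by omega)
    have e4 := h.sym_mul_of_odd (a := n) (c := n + 2) h1 (by omega)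
    have e4' := h.mixed_of_odd (a := n) (c := n + 2) h1 (by omega)
    have hI := h.invariant_eq_zero (a := n + 3) h2 (by omega)
    have hX := mixed_two_even_symm (h.sym_ne _) (h.sym_ne _) hI e1 e1' e2 e2' e4 e4'
    have hY := mixed_two_even (h.sym_ne _) (h.sym_ne _) hI e1 e1' e2 e2' e4 e4'
    have hT := h.anti_mul_of_even h2
    rw [show n + 2 + 1 = n + 3 by ring, show n + 2 - 1 = n + 1 by ring] at hT
    -- Here x = S(n+3)T(n+1), y = S(n+1)T(n+3), X = S(n+4)T(n), Y = S(n)T(n+4), and u, v are the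
    -- terms at n+2.
    linear_combination signed_length_even hX hY (by linear_combination e1') e1 hT rfl
      (by ring : S (n + 3) * T (n + 1) * (S (n + 1) * T (n + 3)) = _)
  · have h2 : Odd (n + 2) := by grind
    have h1 : Even (n + 1) := by grind
    have h3 : Even (n + 3) := by grind
    have e1 := h.sym_mul_of_even (a := n + 4) (c := n + 2) h3 (by omega)
    have e1' := h.mixed_of_even (a := n + 4) (c := n + 2) h3 (by omega)
    have e2 := h.sym_mul_of_odd (a := n + 1) (c := n + 3) h2 (by omega)
    have e2' := h.mixed_of_odd (a := n + 1) (c := n + 3) h2 (by omega)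
    have e3 := h.sym_mul_of_even (a := n) (c := n + 2) h1 (by omega)
    have e3' := h.mixed_of_even (a := n) (c := n + 2) h1 (by omega)
    have hI := h.invariant_eq_zero (a := n + 2) h3 (by omega)
    have hX := mixed_two_odd (h.sym_ne _) (h.sym_ne _) hI e1 e1' e2 e2' e3 e3'
    have hY := mixed_two_odd_symm (h.sym_ne _) (h.sym_ne _) hI e1 e1' e2 e2' e3 e3'
    have hT := h.anti_mul_of_odd h2
    rw [show n + 2 + 1 = n + 3 by ring, show n + 2 - 1 = n + 1 by ring] at hT
    linear_combination signed_length_odd hX hY (by linear_combination e2') e2 hT rfl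
      (by ring : S (n + 3) * T (n + 1) * (S (n + 1) * T (n + 3)) = _)

end SomosPair

/-! ### Duplication formulas. -/

/-- The duplication formulas at the index `m`. -/
structure SomosDouble (S T : ℤ → ℚ) (m : ℤ) : Prop where
  sym_even : Even m → S (2 * m) = S m ^ 4 + 2 * T m ^ 4
  sym_odd : Odd m → S (2 * m) = (2 * S m ^ 4 + T m ^ 4) / 3
  anti : T (2 * m) = -(S m * T m * (S (m + 1) * T (m - 1) - S (m - 1) * T (m + 1)))
  sym_succ : S (2 * m + 1) = S m ^ 2 * S (m + 1) ^ 2 + T m ^ 2 * T (m + 1) ^ 2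
  anti_succ_even : Even m → T (2 * m + 1) = S m ^ 2 * T (m + 1) ^ 2 - 2 * T m ^ 2 * S (m + 1) ^ 2
  anti_succ_odd : Odd m → T (2 * m + 1) = 2 * S m ^ 2 * T (m + 1) ^ 2 - T m ^ 2 * S (m + 1) ^ 2

namespace SomosPair

variable {S T : ℤ → ℚ} {m : ℤ}

theorem double_succ_of_even (h : SomosPair S T) (hm : Even m) (hd : SomosDouble S T m) :
    SomosDouble S T (m + 1) := by
  have h1 : Odd (m + 1) := by grind
  have e1 := h.sym_mul_of_even (a := m - 1) (c := m + 1) hm (by omega)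
  have e1' := h.mixed_of_even (a := m - 1) (c := m + 1) hm (by omega)
  have e2 := h.sym_mul_of_odd (a := m + 2) (c := m) h1 (by omega)
  have e2' := h.mixed_of_odd (a := m + 2) (c := m) h1 (by omega)
  have hI := h.invariant_eq_zero (a := m + 1) hm (by omega)
  have n0 := h.sym_ne m
  have n1 := h.sym_ne (m + 1)
  have f1 := h.sym_mul_of_odd (b := 2 * m + 1) (a := 2 * m + 2) (c := 2 * m) (by grind) (by omega)
  have f1' := h.mixed_of_odd (b := 2 * m + 1) (a := 2 * m + 2) (c := 2 * m) (by grind) (by omega)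
  have f2 := h.sym_mul_of_even (b := 2 * m + 2) (a := 2 * m + 3) (c := 2 * m + 1) (by grind)
    (by omega)
  have f2' := h.mixed_of_even (b := 2 * m + 2) (a := 2 * m + 3) (c := 2 * m + 1) (by grind)
    (by omega)
  have d0 := hd.sym_even hm
  have d2 := hd.sym_succ
  have d3 := hd.anti_succ_even hm
  have k0 : S (2 * m + 2) = (2 * S (m + 1) ^ 4 + T (m + 1) ^ 4) / 3 := by
    refine mul_right_cancel₀ (h.sym_ne (2 * m)) ?_
    have := double_sym_mul (S (m + 1)) (T (m + 1)) (S m) (T m)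
    rw [d2, d3, d0] at f1
    rw [d0]
    linear_combination f1 / 3 - this / 3
  have k1 : T (2 * m + 2) =
      -(S (m + 1) * T (m + 1) * (S (m + 2) * T m - S m * T (m + 2))) := by
    refine mul_left_cancel₀ (h.sym_ne (2 * m)) ?_
    have := double_mixed n1 n0 hI e1 e1' e2 e2'
    rw [d2, d3, d0, hd.anti, k0] at f1'
    rw [d0]
    linear_combination f1' - this
  have k2 : S (2 * m + 3) = S (m + 1) ^ 2 * S (m + 2) ^ 2 + T (m + 1) ^ 2 * T (m + 2) ^ 2 := by
    refine mul_right_cancel₀ (h.sym_ne (2 * m + 1)) ?_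
    have := double_succ_sym_mul_odd n0 hI e2 e2'
    rw [d2, k0, k1] at f2
    rw [d2]
    linear_combination f2 - this
  have k3 : T (2 * m + 3) =
      2 * S (m + 1) ^ 2 * T (m + 2) ^ 2 - T (m + 1) ^ 2 * S (m + 2) ^ 2 := by
    refine mul_left_cancel₀ (h.sym_ne (2 * m + 1)) ?_
    have := double_succ_mixed_odd n0 e2 e2'
    rw [d2, k0, k1, k2, d3] at f2'
    rw [d2]
    linear_combination f2' - this
  have i1 : m + 1 + 1 = m + 2 := by ring
  have i2 : 2 * (m + 1) = 2 * m + 2 := by ring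
  have i3 : 2 * m + 2 + 1 = 2 * m + 3 := by ring
  constructor <;> simp only [i1, i2, i3, add_sub_cancel_right]
  · exact fun h' => absurd h' (Int.not_even_iff_odd.2 h1)
  · exact fun _ => k0
  · exact k1
  · exact k2
  · exact fun h' => absurd h' (Int.not_even_iff_odd.2 h1)
  · exact fun _ => k3

theorem double_succ_of_odd (h : SomosPair S T) (hm : Odd m) (hd : SomosDouble S T m) :
    SomosDouble S T (m + 1) := by
  have h1 : Even (m + 1) := by grind
  have e1 := h.sym_mul_of_even (a := m + 2) (c := m) h1 (by omega)
  have e1' := h.mixed_of_even (a := m + 2) (c := m) h1 (by omega)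
  have e2 := h.sym_mul_of_odd (a := m - 1) (c := m + 1) hm (by omega)
  have e2' := h.mixed_of_odd (a := m - 1) (c := m + 1) hm (by omega)
  have hI := h.invariant_eq_zero (a := m) h1 (by omega)
  have n0 := h.sym_ne m
  have n1 := h.sym_ne (m + 1)
  have f1 := h.sym_mul_of_odd (b := 2 * m + 1) (a := 2 * m + 2) (c := 2 * m) (by grind) (by omega)
  have f1' := h.mixed_of_odd (b := 2 * m + 1) (a := 2 * m + 2) (c := 2 * m) (by grind) (by omega)
  have f2 := h.sym_mul_of_even (b := 2 * m + 2) (a := 2 * m + 3) (c := 2 * m + 1) (by grind)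
    (by omega)
  have f2' := h.mixed_of_even (b := 2 * m + 2) (a := 2 * m + 3) (c := 2 * m + 1) (by grind)
    (by omega)
  have d0 := hd.sym_odd hm
  have d2 := hd.sym_succ
  have d3 := hd.anti_succ_odd hm
  have k0 : S (2 * m + 2) = S (m + 1) ^ 4 + 2 * T (m + 1) ^ 4 := by
    refine mul_right_cancel₀ (h.sym_ne (2 * m)) ?_
    have := double_sym_mul (S m) (T m) (S (m + 1)) (T (m + 1))
    rw [d2, d3, d0] at f1
    rw [d0]
    linear_combination f1 / 3 - this / 3
  have k1 : T (2 * m + 2) =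
      -(S (m + 1) * T (m + 1) * (S (m + 2) * T m - S m * T (m + 2))) := by
    refine mul_left_cancel₀ (h.sym_ne (2 * m)) ?_
    have := double_mixed n0 n1 hI e1 e1' e2 e2'
    rw [d2, d3, d0, hd.anti, k0] at f1'
    rw [d0]
    -- The sign differs from the even case because for odd m the formula for T(2m+1) is the negative
    -- of the form occurring in `double_mixed`.
    linear_combination f1' + this
  have k2 : S (2 * m + 3) = S (m + 1) ^ 2 * S (m + 2) ^ 2 + T (m + 1) ^ 2 * T (m + 2) ^ 2 := by
    refine mul_right_cancel₀ (h.sym_ne (2 * m + 1)) ?_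
    have := double_succ_sym_mul_even n0 hI e1 e1'
    rw [d2, k0, k1] at f2
    rw [d2]
    linear_combination f2 - this
  have k3 : T (2 * m + 3) =
      S (m + 1) ^ 2 * T (m + 2) ^ 2 - 2 * T (m + 1) ^ 2 * S (m + 2) ^ 2 := by
    refine mul_left_cancel₀ (h.sym_ne (2 * m + 1)) ?_
    have := double_succ_mixed_even n0 e1 e1'
    rw [d2, k0, k1, k2, d3] at f2'
    rw [d2]
    linear_combination f2' - this
  have i1 : m + 1 + 1 = m + 2 := by ring
  have i2 : 2 * (m + 1) = 2 * m + 2 := by ring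
  have i3 : 2 * m + 2 + 1 = 2 * m + 3 := by ring
  constructor <;> simp only [i1, i2, i3, add_sub_cancel_right]
  · exact fun _ => k0
  · exact fun h' => absurd h1 (Int.not_even_iff_odd.2 h')
  · exact k1
  · exact k2
  · exact fun _ => k3
  · exact fun h' => absurd h1 (Int.not_even_iff_odd.2 h')

theorem double (h : SomosPair S T) (hS0 : S 0 = 1) (hT0 : T 0 = 0) (hS1 : S 1 = 1) (hT1 : T 1 = 1)
    (m : ℕ) : SomosDouble S T m := by
  induction m with
  | zero => constructor <;> simp [hS0, hT0, hS1, hT1]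
  | succ k ih =>
    push_cast
    rcases Int.even_or_odd (k : ℤ) with hk | hk
    · exact h.double_succ_of_even hk ih
    · exact h.double_succ_of_odd hk ih

end SomosPair

/-! ### Non-vanishing of T. -/

theorem eq_zero_of_sq_eq_mul_sq {d : ℕ} (hd : ¬ IsSquare d) {x y : ℚ} (h : x ^ 2 = d * y ^ 2) :
    y = 0 := by
  by_contra hy
  apply hd
  rw [← Rat.isSquare_natCast_iff]
  exact ⟨x / y, by field_simp; linear_combination -h⟩

theorem eq_zero_of_sq_eq_two_mul_sq {x y : ℚ} (h : x ^ 2 = 2 * y ^ 2) : y = 0 :=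
  eq_zero_of_sq_eq_mul_sq (d := 2) Nat.prime_two.prime.not_isSquare (by exact_mod_cast h)

theorem eq_zero_of_sq_eq_seventeen_mul_sq {x y : ℚ} (h : x ^ 2 = 17 * y ^ 2) : y = 0 :=
  eq_zero_of_sq_eq_mul_sq (d := 17) (by norm_num : Nat.Prime 17).prime.not_isSquare (by exact_mod_cast h)

namespace SomosPair

variable {S T : ℤ → ℚ} {m : ℤ}

/-- Equality would make the two neighbouring ratios a double root. The discriminant is a quadratic
in S(m)², T(m)² whose own discriminant is 153 = 9 · 17, so completing the square would make 17 a
rational square. -/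
theorem mixed_sub_ne_zero (h : SomosPair S T) (m : ℤ) (hT : T m ≠ 0) :
    S (m + 1) * T (m - 1) - S (m - 1) * T (m + 1) ≠ 0 := by
  intro h0
  rcases Int.even_or_odd m with hm | hm
  · have e := h.sym_even m hm
    have e' := h.mixed_even m hm
    have ht := h.anti_mul_of_even hm
    have hq : S (m + 1) * T (m - 1) * (S (m - 1) * T (m + 1)) =
        (S m ^ 2 + T m ^ 2) * (2 * T m ^ 2 - S m ^ 2) := by rw [← e, ← ht]; ring
    have hx : S (m + 1) * T (m - 1) = -(3 * S m * T m) / 2 := by linear_combination h0 / 2 + e' / 2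
    have hy : S (m - 1) * T (m + 1) = -(3 * S m * T m) / 2 := by
      linear_combination -h0 / 2 + e' / 2
    rw [hx, hy] at hq
    have : (8 * S m ^ 2 + 5 * T m ^ 2) ^ 2 = 17 * (3 * T m ^ 2) ^ 2 := by
      linear_combination 64 * hq
    have := eq_zero_of_sq_eq_seventeen_mul_sq this
    simp [hT] at this
  · have e := h.sym_odd m hm
    have e' := h.mixed_odd m hm
    have ht := h.anti_mul_of_odd hm
    have hq : 9 * (S (m + 1) * T (m - 1) * (S (m - 1) * T (m + 1))) =
        (2 * S m ^ 2 + T m ^ 2) * (T m ^ 2 - S m ^ 2) := by rw [← e, ← ht]; ring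
    have hx : S (m + 1) * T (m - 1) = -(S m * T m) / 2 := by linear_combination h0 / 2 + e' / 2
    have hy : S (m - 1) * T (m + 1) = -(S m * T m) / 2 := by linear_combination -h0 / 2 + e' / 2
    rw [hx, hy] at hq
    have : (16 * S m ^ 2 + 5 * T m ^ 2) ^ 2 = 17 * (3 * T m ^ 2) ^ 2 := by
      linear_combination 128 * hq
    have := eq_zero_of_sq_eq_seventeen_mul_sq this
    simp [hT] at this

theorem anti_ne_zero (h : SomosPair S T) (hS0 : S 0 = 1) (hT0 : T 0 = 0) (hS1 : S 1 = 1)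
    (hT1 : T 1 = 1) (n : ℕ) (hn : 0 < n) : T n ≠ 0 := by
  induction n using Nat.strong_induction_on with
  | _ n ih =>
    rcases Nat.even_or_odd' n with ⟨k, rfl | rfl⟩
    · have hk := ih k (by omega) (by omega)
      push_cast
      rw [(h.double hS0 hT0 hS1 hT1 k).anti]
      exact neg_ne_zero.2 (mul_ne_zero (mul_ne_zero (h.sym_ne _) hk) (h.mixed_sub_ne_zero _ hk))
    -- The index 1 is separate: the formula for T(2k+1) uses T(k+1), which for k = 0 is the same
    -- term.
    · rcases k.eq_zero_or_pos with rfl | hk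
      · simp [hT1]
      intro h0
      push_cast at h0
      have hk0 := ih k (by omega) hk
      have hk1 := ih (k + 1) (by omega) (by omega)
      push_cast at hk1
      rcases Int.even_or_odd (k : ℤ) with hm | hm
      · rw [(h.double hS0 hT0 hS1 hT1 k).anti_succ_even hm] at h0
        have : (S k * T (k + 1)) ^ 2 = 2 * (T k * S (k + 1)) ^ 2 := by linear_combination h0
        exact mul_ne_zero hk0 (h.sym_ne _) (eq_zero_of_sq_eq_two_mul_sq this)
      · rw [(h.double hS0 hT0 hS1 hT1 k).anti_succ_odd hm] at h0
        have : (T k * S (k + 1)) ^ 2 = 2 * (S k * T (k + 1)) ^ 2 := by linear_combination -h0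
        exact mul_ne_zero (h.sym_ne _) hk1 (eq_zero_of_sq_eq_two_mul_sq this)

end SomosPair

/-! ### Construction of the pair. -/

/-- The consecutive terms `((S n, T n), (S (n + 1), T (n + 1)))` of the pair starting from
`(1, 0)`, `(1, 1)`; only terms of the first sequence occur as divisors. -/
def somosState : ℕ → (ℚ × ℚ) × (ℚ × ℚ)
  | 0 => ((1, 0), (1, 1))
  | n + 1 =>
    let x := (somosState n).1
    let y := (somosState n).2
    let s := if Even n then (2 * y.1 ^ 2 + y.2 ^ 2) / (3 * x.1) else (y.1 ^ 2 + y.2 ^ 2) / x.1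
    let k : ℚ := if Even n then 1 else 3
    (y, (s, -(k * y.1 * y.2 + s * x.2) / x.1))

def somosSym (n : ℕ) : ℚ := (somosState n).1.1

def somosAnti (n : ℕ) : ℚ := (somosState n).1.2

theorem somosSym_succ_succ_even {n : ℕ} (hn : Even n) :
    somosSym (n + 2) = (2 * somosSym (n + 1) ^ 2 + somosAnti (n + 1) ^ 2) / (3 * somosSym n) := by
  simp [somosSym, somosAnti, somosState, hn]

theorem somosSym_succ_succ_odd {n : ℕ} (hn : Odd n) :
    somosSym (n + 2) = (somosSym (n + 1) ^ 2 + somosAnti (n + 1) ^ 2) / somosSym n := by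
  simp [somosSym, somosAnti, somosState, Nat.not_even_iff_odd.2 hn]

theorem somosAnti_succ_succ_even {n : ℕ} (hn : Even n) :
    somosAnti (n + 2) =
      -(somosSym (n + 1) * somosAnti (n + 1) + somosSym (n + 2) * somosAnti n) / somosSym n := by
  simp [somosSym, somosAnti, somosState, hn]

theorem somosAnti_succ_succ_odd {n : ℕ} (hn : Odd n) :
    somosAnti (n + 2) =
      -(3 * somosSym (n + 1) * somosAnti (n + 1) + somosSym (n + 2) * somosAnti n) /
        somosSym n := by
  simp [somosSym, somosAnti, somosState, Nat.not_even_iff_odd.2 hn]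

theorem somosSym_zero : somosSym 0 = 1 := rfl
theorem somosSym_one : somosSym 1 = 1 := rfl
theorem somosAnti_zero : somosAnti 0 = 0 := rfl
theorem somosAnti_one : somosAnti 1 = 1 := rfl

theorem somosSym_pos (n : ℕ) : 0 < somosSym n ∧ 0 < somosSym (n + 1) := by
  induction n with
  | zero => simp [somosSym_zero, somosSym_one]
  | succ k ih =>
    obtain ⟨h0, h1⟩ := ih
    refine ⟨h1, ?_⟩
    rcases k.even_or_odd with hk | hk
    · rw [somosSym_succ_succ_even hk]; positivity
    · rw [somosSym_succ_succ_odd hk]; positivity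

theorem somosSym_ne_zero (n : ℕ) : somosSym n ≠ 0 := (somosSym_pos n).1.ne'

theorem sym_mul_nat_even {n : ℕ} (hn : Even n) :
    3 * (somosSym (n + 2) * somosSym n) = 2 * somosSym (n + 1) ^ 2 + somosAnti (n + 1) ^ 2 := by
  have := somosSym_ne_zero n
  rw [somosSym_succ_succ_even hn]; field_simp

theorem sym_mul_nat_odd {n : ℕ} (hn : Odd n) :
    somosSym (n + 2) * somosSym n = somosSym (n + 1) ^ 2 + somosAnti (n + 1) ^ 2 := by
  have := somosSym_ne_zero n
  rw [somosSym_succ_succ_odd hn]; field_simp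

theorem mixed_nat_even {n : ℕ} (hn : Even n) :
    somosSym (n + 2) * somosAnti n + somosSym n * somosAnti (n + 2) =
      -(somosSym (n + 1) * somosAnti (n + 1)) := by
  have := somosSym_ne_zero n
  rw [somosAnti_succ_succ_even hn]; field_simp; ring

theorem mixed_nat_odd {n : ℕ} (hn : Odd n) :
    somosSym (n + 2) * somosAnti n + somosSym n * somosAnti (n + 2) =
      -(3 * somosSym (n + 1) * somosAnti (n + 1)) := by
  have := somosSym_ne_zero n
  rw [somosAnti_succ_succ_odd hn]; field_simp; ring

theorem invariant_nat (n : ℕ) :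
    (Even n → invariant (somosSym (n + 1)) (somosAnti (n + 1)) (somosSym n) (somosAnti n) = 0) ∧
      (Odd n →
        invariant (somosSym n) (somosAnti n) (somosSym (n + 1)) (somosAnti (n + 1)) = 0) := by
  induction n with
  | zero => simp [invariant, somosSym_zero, somosSym_one, somosAnti_zero, somosAnti_one]
  | succ k ih =>
    rcases k.even_or_odd with hk | hk
    · refine ⟨fun h => by grind, fun _ => ?_⟩
      exact invariant_succ_odd (somosSym_ne_zero k) (ih.1 hk) (sym_mul_nat_even hk)
        (mixed_nat_even hk)
    · refine ⟨fun _ => ?_, fun h => by grind⟩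
      exact invariant_succ_even (somosSym_ne_zero k) (ih.2 hk) (sym_mul_nat_odd hk)
        (mixed_nat_odd hk)

/-! ### Extension to negative indices by parity. -/

def somosSymInt (n : ℤ) : ℚ := somosSym n.natAbs

def somosAntiInt (n : ℤ) : ℚ := n.sign * somosAnti n.natAbs

theorem somosSymInt_neg (n : ℤ) : somosSymInt (-n) = somosSymInt n := by simp [somosSymInt]

theorem somosAntiInt_neg (n : ℤ) : somosAntiInt (-n) = -somosAntiInt n := by simp [somosAntiInt]

theorem somosSymInt_natCast (n : ℕ) : somosSymInt n = somosSym n := rfl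

theorem somosAntiInt_natCast (n : ℕ) : somosAntiInt n = somosAnti n := by
  rcases n with _ | n
  · simp [somosAntiInt, somosAnti_zero]
  · rw [somosAntiInt, Int.sign_natCast_of_ne_zero (by omega), Int.natAbs_natCast, Int.cast_one, one_mul]

/-- Induction on the absolute value for statements invariant under negation. -/
theorem int_rec_neg {P : ℤ → Prop} (neg : ∀ n, P n → P (-n)) (nat : ∀ n : ℕ, P n) (n : ℤ) :
    P n := by
  rcases n.eq_nat_or_neg with ⟨k, rfl | rfl⟩
  exacts [nat k, neg _ (nat k)]

theorem somosPair_int : SomosPair somosSymInt somosAntiInt where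
  sym_ne n := somosSym_ne_zero _
  sym_even n := by
    induction n using int_rec_neg with
    | neg n ih =>
      intro hn
      rw [show -n + 1 = -(n - 1) by ring, show -n - 1 = -(n + 1) by ring]
      simp only [somosSymInt_neg, somosAntiInt_neg]
      linear_combination ih (by simpa using hn)
    | nat n =>
      intro hn
      rcases n with _ | k
      · simp [somosSymInt, somosAntiInt, somosSym_zero, somosSym_one]
      · have := sym_mul_nat_odd (n := k) (by grind)
        simp only [← somosSymInt_natCast, ← somosAntiInt_natCast] at this
        push_cast at this ⊢
        rw [add_sub_cancel_right, add_assoc]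
        exact this
  sym_odd n := by
    induction n using int_rec_neg with
    | neg n ih =>
      intro hn
      rw [show -n + 1 = -(n - 1) by ring, show -n - 1 = -(n + 1) by ring]
      simp only [somosSymInt_neg, somosAntiInt_neg]
      linear_combination ih (by simpa using hn)
    | nat n =>
      intro hn
      rcases n with _ | k
      · simp at hn
      · have := sym_mul_nat_even (n := k) (by grind)
        simp only [← somosSymInt_natCast, ← somosAntiInt_natCast] at this
        push_cast at this ⊢
        rw [add_sub_cancel_right, add_assoc]
        exact this
  mixed_even n := by
    induction n using int_rec_neg with
    | neg n ih =>
      intro hn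
      rw [show -n + 1 = -(n - 1) by ring, show -n - 1 = -(n + 1) by ring]
      simp only [somosSymInt_neg, somosAntiInt_neg]
      linear_combination -ih (by simpa using hn)
    | nat n =>
      intro hn
      rcases n with _ | k
      · simp [somosSymInt, somosAntiInt]
      · have := mixed_nat_odd (n := k) (by grind)
        simp only [← somosSymInt_natCast, ← somosAntiInt_natCast] at this
        push_cast at this ⊢
        rw [add_sub_cancel_right, add_assoc]
        exact this
  mixed_odd n := by
    induction n using int_rec_neg with
    | neg n ih =>
      intro hn
      rw [show -n + 1 = -(n - 1) by ring, show -n - 1 = -(n + 1) by ring]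
      simp only [somosSymInt_neg, somosAntiInt_neg]
      linear_combination -ih (by simpa using hn)
    | nat n =>
      intro hn
      rcases n with _ | k
      · simp at hn
      · have := mixed_nat_even (n := k) (by grind)
        simp only [← somosSymInt_natCast, ← somosAntiInt_natCast] at this
        push_cast at this ⊢
        rw [add_sub_cancel_right, add_assoc]
        exact this
  invariant_even n hn := by
    rcases le_or_gt 0 n with h | h
    · lift n to ℕ using h
      have := (invariant_nat n).1 (by exact_mod_cast hn)
      simpa only [← somosSymInt_natCast, ← somosAntiInt_natCast, Nat.cast_succ] using this
    -- Reflection takes the indices n, n+1 to k+1, k, so the parity of the lower index flips; the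
    -- form is unchanged when both `q` and `v` change sign.
    · obtain ⟨k, rfl⟩ : ∃ k : ℕ, n = -(k + 1) := ⟨(-n - 1).toNat, by omega⟩
      have := (invariant_nat k).2 (by grind)
      simp only [← somosSymInt_natCast, ← somosAntiInt_natCast, Nat.cast_succ] at this
      rw [show -((k : ℤ) + 1) + 1 = -k by ring]
      simp only [somosSymInt_neg, somosAntiInt_neg, invariant] at this ⊢
      linear_combination this
  invariant_odd n hn := by
    rcases le_or_gt 0 n with h | h
    · lift n to ℕ using h
      have := (invariant_nat n).2 (by exact_mod_cast hn)
      simpa only [← somosSymInt_natCast, ← somosAntiInt_natCast, Nat.cast_succ] using this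
    · obtain ⟨k, rfl⟩ : ∃ k : ℕ, n = -(k + 1) := ⟨(-n - 1).toNat, by omega⟩
      have := (invariant_nat k).1 (by grind)
      simp only [← somosSymInt_natCast, ← somosAntiInt_natCast, Nat.cast_succ] at this
      rw [show -((k : ℤ) + 1) + 1 = -k by ring]
      simp only [somosSymInt_neg, somosAntiInt_neg, invariant] at this ⊢
      linear_combination this

theorem somosAnti_ne_zero (n : ℕ) (hn : 0 < n) : somosAnti n ≠ 0 := by
  rw [← somosAntiInt_natCast]
  refine somosPair_int.anti_ne_zero ?_ ?_ ?_ ?_ n hn <;>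
    simp [somosSymInt, somosAntiInt, somosSym_zero, somosSym_one, somosAnti_one]

/-! ### Identification with the given sequences. -/

/-- A sequence without zeros that satisfies the Somos-5 recurrence is its forward orbit. -/
theorem eq_somos5 {f : ℕ → ℚ} (hf : ∀ n, f n ≠ 0)
    (h : ∀ n, f (n + 5) * f n = f (n + 4) * f (n + 1) + f (n + 3) * f (n + 2)) (n : ℕ) :
    somos5 (f 0) (f 1) (f 2) (f 3) (f 4) n = f n := by
  induction n using Nat.strong_induction_on with
  | _ n ih =>
    match n with
    | 0 | 1 | 2 | 3 | 4 => rfl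
    | n + 5 =>
      rw [somos5, ih _ (by omega), ih _ (by omega), ih _ (by omega), ih _ (by omega),
        ih _ (by omega), ← h, mul_div_cancel_right₀ _ (hf n)]

theorem somosSym_eq (n : ℕ) : somos5 1 1 1 2 3 n = somosSym n := by
  have h (n : ℕ) := (somosPair_int.somos_five n).1
  have key := eq_somos5 somosSym_ne_zero (fun n => by exact_mod_cast h n) n
  have h2 : somosSym 2 = 1 := by norm_num [somosSym, somosState]
  have h3 : somosSym 3 = 2 := by norm_num [somosSym, somosState]
  have h4 : somosSym 4 = 3 := by norm_num [somosSym, somosState, Nat.even_add_one]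
  rwa [somosSym_zero, somosSym_one, h2, h3, h4] at key

theorem somosAnti_eq (n : ℕ) : somos5 1 (-1) 1 1 (-7) n = somosAnti (n + 1) := by
  have h (n : ℕ) := (somosPair_int.somos_five (n + 1 : ℕ)).2
  have h' (n : ℕ) : somosAnti (n + 1 + 5) * somosAnti (n + 1) =
      somosAnti (n + 1 + 4) * somosAnti (n + 1 + 1) +
        somosAnti (n + 1 + 3) * somosAnti (n + 1 + 2) := by
    simp only [← somosAntiInt_natCast]
    exact_mod_cast h n
  -- The shift by one avoids the divisor T(0) = 0.
  have key := eq_somos5 (f := fun n => somosAnti (n + 1)) (fun n => somosAnti_ne_zero _ n.succ_pos)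
    (fun n => by simpa only [add_right_comm] using h' n) n
  have h2 : somosAnti 2 = -1 := by norm_num [somosAnti, somosState]
  have h3 : somosAnti 3 = 1 := by norm_num [somosAnti, somosState]
  have h4 : somosAnti 4 = 1 := by norm_num [somosAnti, somosState, Nat.even_add_one]
  have h5 : somosAnti 5 = -7 := by norm_num [somosAnti, somosState, Nat.even_add_one]
  simpa [somosAnti_one, h2, h3, h4, h5] using key

theorem somosS_eq (n : ℤ) : somosS n = somosSymInt n := somosSym_eq _

theorem somosT_eq (n : ℤ) : somosT n = somosAntiInt n := by
  rcases eq_or_ne n 0 with rfl | hn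
  · simp [somosT, somosAntiInt]
  · rw [somosT, somosAnti_eq, Nat.sub_add_cancel (by omega), somosAntiInt]

/-- The signed lengths satisfy `s̄ n = ā n + b̄ n + c̄ n` for all integers `n`. -/
theorem lemma3p1 (n : ℤ) : sBar n = aBar n + bBar n + cBar n := by
  simp only [sBar, aBar, bBar, cBar, somosS_eq, somosT_eq]
  exact somosPair_int.signed_length n
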